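/- Let $x:\mathbb C\to\mathbb C$ be a nonuniform lattice, i.e. either $x(s)=c_1q^{s}+c_2q^{-s}+c_3$ with $q\in\mathbb C\setminus\{0,1\}$, $c_1c_2\ne 0$ (principal power), or $x(s)=c_1s^2+c_2s+c_3$ with $c_1c_2\neq 0$. Put $x_k(s)=x(s+\tfrac k2)$ for $k\in\mathbb Z$, $\Delta f(s)=f(s+1)-f(s)$, $\nabla f(s)=f(s)-f(s-1)$, $\Delta_kf=\dfrac{\Delta f}{\Delta x_k}$, $\nabla_kf=\dfrac{\nabla f}{\nabla x_k}$, and $\Delta_k^{(n)}=\Delta_{k+n-1}\cdots\Delta_{k+1}\Delta_k$. For $N\in\mathbb C$ and $s\in N+\mathbb Z$ put $$\int_N^s g(t)\,d_\nabla x_k(t)=\sum_{t=N}^{s}g(t)\nabla x_k(t),$$ the sum being over $t=N,N+1,\dots,s$, empty for $s=N-1$, and equal to $-\sum_{t=s+1}^{N-1}g(t)\nabla x_k(t)$ for $s<N-1$ (that is, when $s-N<-1$). Let $\widetilde\sigma,\widetilde\tau$ be complex polynomials of degree at most $2$ and at most $1$, and let $$\tau(s)=\widetilde\tau[x(s)],\qquad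 \sigma(s)=\widetilde\sigma[x(s)]-\tfrac12\widetilde\tau[x(s)]\,\nabla x_1(s),\qquad \tau_k(s)=\frac{\sigma(s+k)-\sigma(s)+\tau(s+k)\nabla x_1(s+k)}{\nabla x_{k+1}(s)},$$ $$\lambda_n=-\sum_{j=0}^{n-1}\Delta_j\tau_j(s)$$ (which does not depend on $s$). Let $N\in\mathbb C$ be such that $\Delta x_k(s)\ne0$ and $\sigma(s)\neq 0$ for all $s\in N+\mathbb Z$, $k\in\mathbb Z$, and let $\rho$ be a function with $\rho(s)\ne 0$ satisfying the Pearson equation $\Delta_{-1}[\sigma(s)\rho(s)]=\tau(s)\rho(s)$ for all $s\in N+\mathbb Z$. **Theorem.** Let $n\ge1$ be an integer, and suppose $\lambda=\lambda_n$ and $\lambda_m\neq\lambda_n$ for $m=0,1,\dots,n-1$. Then the general solution on $N+\mathbb Z$ of $$\widetilde{\sigma}[x(s)]\,\Delta_{-1}\nabla_{0}y(s)+\frac{\widetilde{\tau}[x(s)]}{2}\left[\Delta_{0}y(s)+\nabla_{0}y(s)\right]+\lambda y(s)=0$$ is $$y(s)=\frac{C}{\rho(s)}\Delta_{-n}^{(n)}\Bigl[\rho(s)\prod_{j=0}^{n-1}\sigma(s-j)\Bigr]+\frac1{\rho(s)}\Delta_{-n}^{(n)}\Bigl[\rho(s)\prod_{j=0}^{n-1}\sigma(s-j)\int_N^s\frac{P_n[x_{-(n+1)}(t)]}{\rho(t)\prod_{j=0}^{n}\sigma(t-j)}\,d_\nabla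 x_{-n}(t)\Bigr],$$ where $C$ is an arbitrary constant and $P_n$ is an arbitrary polynomial of degree $n$. That is, a function $y$ satisfies the equation at every $s\in N+\mathbb Z$ if and only if there are $C\in\mathbb C$ and a complex polynomial $P_n$ of degree exactly $n$ for which this formula holds at every $s\in N+\mathbb Z$. -/

import Mathlib

open Polynomial

/-- The lattice functions `x(s) = c₁ q ^ s + c₂ q ^ (-s) + c₃` and
`x(s) = c₁ s ^ 2 + c₂ s + c₃`, with `c₁ c₂ ≠ 0`. -/
def IsNonuniformLattice (x : ℂ → ℂ) : Prop :=
  (∃ q c₁ c₂ c₃ : ℂ, q ≠ 0 ∧ q ≠ 1 ∧ c₁ * c₂ ≠ 0 ∧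
      ∀ s : ℂ, x s = c₁ * q ^ s + c₂ * q ^ (-s) + c₃) ∨
  (∃ c₁ c₂ c₃ : ℂ, c₁ * c₂ ≠ 0 ∧ ∀ s : ℂ, x s = c₁ * s ^ 2 + c₂ * s + c₃)

/-- The points `N + m`, `m ∈ ℤ`. -/
def latticePoints (N : ℂ) : Set ℂ := {s | ∃ m : ℤ, s = N + m}

/-- `x_k(s) = x(s + k / 2)`. -/
noncomputable def shiftedLattice (x : ℂ → ℂ) (k : ℤ) (s : ℂ) : ℂ := x (s + (k : ℂ) / 2)

/-- `Δ f(s) = f(s + 1) - f(s)`. -/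
def forwardDiff (f : ℂ → ℂ) (s : ℂ) : ℂ := f (s + 1) - f s

/-- `∇ f(s) = f(s) - f(s - 1)`. -/
def backwardDiff (f : ℂ → ℂ) (s : ℂ) : ℂ := f s - f (s - 1)

/-- `Δ_k f(s) = Δ f(s) / Δ x_k(s)`. -/
noncomputable def deltaOp (x : ℂ → ℂ) (k : ℤ) (f : ℂ → ℂ) (s : ℂ) : ℂ :=
  forwardDiff f s / forwardDiff (shiftedLattice x k) s

/-- `∇_k f(s) = ∇ f(s) / ∇ x_k(s)`. -/
noncomputable def nablaOp (x : ℂ → ℂ) (k : ℤ) (f : ℂ → ℂ) (s : ℂ) : ℂ :=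
  backwardDiff f s / backwardDiff (shiftedLattice x k) s

/-- `Δ_k^{(n)} = Δ_{k+n-1} ⋯ Δ_{k+1} Δ_k`, and `Δ_k^{(0)} f = f`. -/
noncomputable def deltaIter (x : ℂ → ℂ) (k : ℤ) : ℕ → (ℂ → ℂ) → ℂ → ℂ
  | 0, f => f
  | n + 1, f => deltaOp x (k + n) (deltaIter x k n f)

/-- `∫_N^s g(t) d_∇ x_k(t) = ∑_{t = N}^{s} g(t) ∇ x_k(t)`, for `s = N + m` with `m` an integer.
As usual the sum is empty for `m = -1` and, for `m < -1`, it is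
`-∑_{t = s + 1}^{N - 1} g(t) ∇ x_k(t)`, so that `∇_k` of the integral is `g` at every `N + m`. -/
noncomputable def nablaIntegral (x : ℂ → ℂ) (k : ℤ) (N s : ℂ) (g : ℂ → ℂ) : ℂ :=
  (∑ i ∈ Finset.Icc (0 : ℤ) ⌊(s - N).re⌋,
      g (N + i) * backwardDiff (shiftedLattice x k) (N + i)) -
    ∑ i ∈ Finset.Icc (⌊(s - N).re⌋ + 1) (-1 : ℤ),
      g (N + i) * backwardDiff (shiftedLattice x k) (N + i)

/-- `τ(s) = τ̃[x(s)]`. -/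
noncomputable def tauFun (x : ℂ → ℂ) (τt : ℂ[X]) (s : ℂ) : ℂ := τt.eval (x s)

/-- `σ(s) = σ̃[x(s)] - (1/2) τ̃[x(s)] ∇ x_1(s)`. -/
noncomputable def sigmaFun (x : ℂ → ℂ) (σt τt : ℂ[X]) (s : ℂ) : ℂ :=
  σt.eval (x s) - 1 / 2 * τt.eval (x s) * backwardDiff (shiftedLattice x 1) s

/-- `τ_k(s) = (σ(s + k) - σ(s) + τ(s + k) ∇ x_1(s + k)) / ∇ x_{k+1}(s)`. -/
noncomputable def tauSeq (x : ℂ → ℂ) (σt τt : ℂ[X]) (k : ℤ) (s : ℂ) : ℂ :=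
  (sigmaFun x σt τt (s + k) - sigmaFun x σt τt s
      + tauFun x τt (s + k) * backwardDiff (shiftedLattice x 1) (s + k)) /
    backwardDiff (shiftedLattice x (k + 1)) s

/-- `λ_n = -∑_{j=0}^{n-1} Δ_j τ_j(s)`. On a nonuniform lattice the value does not depend on the
point `s` at which the right-hand side is evaluated (as long as the steps do not vanish). -/
noncomputable def lambdaSeq (x : ℂ → ℂ) (σt τt : ℂ[X]) (n : ℕ) (s : ℂ) : ℂ :=
  -∑ j ∈ Finset.range n, deltaOp x j (tauSeq x σt τt j) s

/-- The left-hand side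
`σ̃[x(s)] Δ_{-1} ∇_0 y(s) + (τ̃[x(s)] / 2) (Δ_0 y(s) + ∇_0 y(s)) + lam y(s)`
of the difference equation of hypergeometric type. -/
noncomputable def hypergeometricOp (x : ℂ → ℂ) (σt τt : ℂ[X]) (lam : ℂ) (y : ℂ → ℂ) (s : ℂ) : ℂ :=
  σt.eval (x s) * deltaOp x (-1) (nablaOp x 0 y) s
    + τt.eval (x s) / 2 * (deltaOp x 0 y s + nablaOp x 0 y s) + lam * y s

/-- The Pearson type equation `Δ_{-1} [σ(s) ρ(s)] = τ(s) ρ(s)` at the point `s`. -/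
def PearsonAt (x : ℂ → ℂ) (σt τt : ℂ[X]) (ρ : ℂ → ℂ) (s : ℂ) : Prop :=
  deltaOp x (-1) (fun t => sigmaFun x σt τt t * ρ t) s = tauFun x τt s * ρ s

/-- `ρ(s) ∏_{j=0}^{m-1} σ(s - j)`. -/
noncomputable def weightProd (x : ℂ → ℂ) (σt τt : ℂ[X]) (ρ : ℂ → ℂ) (m : ℕ) (s : ℂ) : ℂ :=
  ρ s * ∏ j ∈ Finset.range m, sigmaFun x σt τt (s - j)

/-! Write X i = x(N + i/2). Both kinds of lattice satisfy X(i+1) + X(i-1) = 2α X(i) + β, and the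
argument uses nothing else about x.

Let A_n be the first order operator `seqAdjoint`. By the Pearson equation, ρ times the
hypergeometric operator applied to y is Δ_{-1} A_0 (ρy) + λρy (`mul_seqHypergeometric`). The numbers
κ_k = Δ_k τ_k are constant (`seqDelta_seqTau`), and Δ_{-n-1} A_n = A_{n-1} Δ_{-n} - κ_{n-1}
(`seqDelta_seqAdjoint`). Writing ρy = Δ_{-n}^{(n)} v, which is always possible, and iterating gives
Δ_{-n-1}^{(n+1)} A_n v = ρ times the operator with λ = λ_n applied to y. So y is a solution exactly
when A_n v lies in the kernel of Δ_{-n-1}^{(n+1)}.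

That kernel consists of the polynomials of degree at most n in x_{-(n+1)}, provided U_{j-1}(α) ≠ 0
for 1 ≤ j ≤ n (`exists_eval_of_seqDeltaIter_eq_zero`). The proviso follows from λ_m ≠ λ_n, since
U_{j-1}(α) = 0 would force λ_{n-j} = λ_n. The equation A_n v = P_n is then solved by variation of
constants (`seqAdjoint_eq_iff`), which produces the formula.

The degree can be taken exactly n because v is not unique: adding a suitable q with Δ_{-n}^{(n)} q =
0 changes the leading coefficient of A_n v, as λ_n ≠ λ_0 = 0. -/

/-! ### Second order recurrences with constant coefficients -/

/-- The quantum integer `U_{k-1}(α)`, equal to `(p ^ k - p ^ (-k)) / (p - p⁻¹)` for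
`α = (p + p⁻¹) / 2`. -/
noncomputable def chebU (α : ℂ) (k : ℤ) : ℂ := (Chebyshev.U ℂ (k - 1)).eval α

/-- The value `T_k(α)`, equal to `(p ^ k + p ^ (-k)) / 2` for `α = (p + p⁻¹) / 2`. -/
noncomputable def chebT (α : ℂ) (k : ℤ) : ℂ := (Chebyshev.T ℂ k).eval α

theorem chebU_zero (α : ℂ) : chebU α 0 = 0 := by simp [chebU]

theorem chebU_one (α : ℂ) : chebU α 1 = 1 := by simp [chebU]

theorem chebT_zero (α : ℂ) : chebT α 0 = 1 := by simp [chebT]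

theorem chebT_one (α : ℂ) : chebT α 1 = α := by simp [chebT]

theorem chebU_add_one (α : ℂ) (k : ℤ) :
    chebU α (k + 1) + chebU α (k - 1) = 2 * α * chebU α k := by
  have h := congrArg (eval α) (Chebyshev.U_add_one ℂ (k - 1))
  simp only [eval_sub, eval_mul, eval_X, eval_ofNat] at h
  simp only [chebU]
  rw [show k + 1 - 1 = k - 1 + 1 by ring, h]
  ring

theorem chebT_add_one (α : ℂ) (k : ℤ) :
    chebT α (k + 1) + chebT α (k - 1) = 2 * α * chebT α k := by
  have h := congrArg (eval α) (Chebyshev.T_add_one ℂ k)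
  simp only [eval_sub, eval_mul, eval_X, eval_ofNat] at h
  simp only [chebT, h]
  ring

theorem chebU_add_one_eq (α : ℂ) (k : ℤ) :
    chebU α (k + 1) = α * chebU α k + chebT α k := by
  have h := congrArg (eval α) (Chebyshev.U_eq_X_mul_U_add_T ℂ (k - 1))
  simp only [eval_add, eval_mul, eval_X] at h
  simp only [chebU, chebT]
  rw [show k + 1 - 1 = k - 1 + 1 by ring, h]
  simp

section Recurrence

variable {X : ℤ → ℂ} {α β : ℂ}

theorem sub_eq_chebU_mul (hX : ∀ i, X (i + 1) + X (i - 1) = 2 * α * X i + β) (k : ℕ) (j : ℤ) :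
    X (j + k) - X (j - k) = chebU α k * (X (j + 1) - X (j - 1)) := by
  induction k using Nat.twoStepInduction with
  | zero => simp [chebU_zero]
  | one => simp [chebU_one]
  | more k h0 h1 =>
    have h2 := hX (j + (k + 1))
    have h3 := hX (j - (k + 1))
    have h4 := chebU_add_one α (k + 1)
    push_cast at h0 h1 h2 h3 h4 ⊢
    rw [show j + ((k : ℤ) + 1) + 1 = j + (k + 2) by ring,
      show j + ((k : ℤ) + 1) - 1 = j + k by ring] at h2
    rw [show j - ((k : ℤ) + 1) - 1 = j - (k + 2) by ring,
      show j - ((k : ℤ) + 1) + 1 = j - k by ring] at h3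
    rw [show (k : ℤ) + 1 + 1 = k + 2 by ring, show (k : ℤ) + 1 - 1 = k by ring] at h4
    linear_combination h2 - h3 - h0 + 2 * α * h1 - (X (j + 1) - X (j - 1)) * h4

theorem exists_add_eq_chebT_mul (hX : ∀ i, X (i + 1) + X (i - 1) = 2 * α * X i + β) (k : ℕ) :
    ∃ b : ℂ, ∀ j, X (j + k) + X (j - k) = 2 * chebT α k * X j + b := by
  induction k using Nat.twoStepInduction with
  | zero => exact ⟨0, fun j => by simp [chebT_zero, two_mul]⟩
  | one => exact ⟨β, fun j => by simpa [chebT_one] using hX j⟩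
  | more k h0 h1 =>
    obtain ⟨b0, h0⟩ := h0
    obtain ⟨b1, h1⟩ := h1
    refine ⟨2 * α * b1 + 2 * β - b0, fun j => ?_⟩
    have h2 := hX (j + (k + 1))
    have h3 := hX (j - (k + 1))
    have h4 := chebT_add_one α (k + 1)
    have h0 := h0 j
    have h1 := h1 j
    push_cast at h0 h1 h2 h3 h4 ⊢
    rw [show j + ((k : ℤ) + 1) + 1 = j + (k + 2) by ring,
      show j + ((k : ℤ) + 1) - 1 = j + k by ring] at h2
    rw [show j - ((k : ℤ) + 1) - 1 = j - (k + 2) by ring,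
      show j - ((k : ℤ) + 1) + 1 = j - k by ring] at h3
    rw [show (k : ℤ) + 1 + 1 = k + 2 by ring, show (k : ℤ) + 1 - 1 = k by ring] at h4
    linear_combination h2 + h3 - h0 + 2 * α * h1 - 2 * X j * h4

theorem add_eq_chebT_mul (hX : ∀ i, X (i + 1) + X (i - 1) = 2 * α * X i) (k : ℕ) (j : ℤ) :
    X (j + k) + X (j - k) = 2 * chebT α k * X j := by
  induction k using Nat.twoStepInduction with
  | zero => simp [chebT_zero, two_mul]
  | one => simpa [chebT_one] using hX j
  | more k h0 h1 =>
    have h2 := hX (j + (k + 1))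
    have h3 := hX (j - (k + 1))
    have h4 := chebT_add_one α (k + 1)
    push_cast at h0 h1 h2 h3 h4 ⊢
    rw [show j + ((k : ℤ) + 1) + 1 = j + (k + 2) by ring,
      show j + ((k : ℤ) + 1) - 1 = j + k by ring] at h2
    rw [show j - ((k : ℤ) + 1) - 1 = j - (k + 2) by ring,
      show j - ((k : ℤ) + 1) + 1 = j - k by ring] at h3
    rw [show (k : ℤ) + 1 + 1 = k + 2 by ring, show (k : ℤ) + 1 - 1 = k by ring] at h4
    linear_combination h2 + h3 - h0 + 2 * α * h1 - 2 * X j * h4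

/-- A geometric sum with step two: it equals its central term times a quantum integer, so it
vanishes with `chebU α j` whatever the sequence. -/
theorem sum_eq_chebU_mul (hX : ∀ i, X (i + 1) + X (i - 1) = 2 * α * X i) (m : ℤ) (j : ℕ) :
    ∑ k ∈ Finset.range j, X (2 * (m + k)) = chebU α j * X (2 * m + j - 1) := by
  induction j with
  | zero => simp [chebU_zero]
  | succ j ih =>
    have h1 := sub_eq_chebU_mul (β := 0) (by simpa using hX) j (2 * m + j)
    have h2 := add_eq_chebT_mul hX j (2 * m + j)
    have h3 := hX (2 * m + j)
    have h4 := chebU_add_one_eq α j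
    rw [Finset.sum_range_succ, ih, show 2 * (m + (j : ℤ)) = 2 * m + j + j by ring]
    push_cast
    rw [show 2 * m + ((j : ℤ) + 1) - 1 = 2 * m + j by ring]
    linear_combination (h1 + h2 + chebU α j * h3) / 2 - X (2 * m + j) * h4

/-- X(i+1) X(i-1) - X(i)² + β X(i) is a first integral of the recurrence. Hence the neighbours
X(i+1) and X(i-1) have sum and product polynomial in X(i), and so does every symmetric polynomial in
them. -/
theorem add_mul_sub_mul_const (hX : ∀ i, X (i + 1) + X (i - 1) = 2 * α * X i + β) :
    ∃ γ : ℂ, ∀ i, X (i + 1) * X (i - 1) = X i ^ 2 - β * X i + γ := by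
  refine ⟨X 1 * X (-1) - X 0 ^ 2 + β * X 0, fun i => ?_⟩
  induction i using Int.induction_on with
  | zero => simp
  | succ i ih =>
    have h1 := hX i
    have h2 := hX (i + 1)
    rw [add_sub_cancel_right] at h2 ⊢
    linear_combination ih + X i * h2 - X (i + 1) * h1
  | pred i ih =>
    have h1 := hX (-i)
    have h2 := hX (-i - 1)
    rw [sub_add_cancel] at h2 ⊢
    linear_combination ih + X (-i) * h2 - X (-i - 1) * h1

end Recurrence

/-! ### Divided differences of polynomials -/

/-- The complete homogeneous polynomial of degree `n` in the roots of
`T ^ 2 - (2 α X + β) T + (X ^ 2 - β X + γ)`. -/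
noncomputable def homogeneousPoly (α β γ : ℂ) : ℕ → ℂ[X]
  | 0 => 1
  | 1 => C (2 * α) * X + C β
  | n + 2 => (C (2 * α) * X + C β) * homogeneousPoly α β γ (n + 1) -
      (X ^ 2 - C β * X + C γ) * homogeneousPoly α β γ n

theorem natDegree_homogeneousPoly_le (α β γ : ℂ) (n : ℕ) :
    (homogeneousPoly α β γ n).natDegree ≤ n := by
  induction n using Nat.twoStepInduction with
  | zero => simp [homogeneousPoly]
  | one => exact natDegree_linear_le
  | more n h0 h1 =>
    rw [homogeneousPoly]
    refine (natDegree_sub_le _ _).trans (max_le ?_ ?_)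
    · refine natDegree_mul_le.trans ?_
      have : (C (2 * α) * X + C β).natDegree ≤ 1 := natDegree_linear_le
      omega
    · refine natDegree_mul_le.trans ?_
      have : (X ^ 2 - C β * X + C γ).natDegree ≤ 2 := by compute_degree
      omega

/-- Top coefficients inherit the Chebyshev recurrence. Their vanishing is the only obstruction to
inverting the divided difference on polynomials. -/
theorem coeff_homogeneousPoly (α β γ : ℂ) (n : ℕ) :
    (homogeneousPoly α β γ n).coeff n = chebU α (n + 1) := by
  induction n using Nat.twoStepInduction with
  | zero => simp [homogeneousPoly, chebU_one]
  | one =>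
    have := chebU_add_one α 1
    rw [sub_self, chebU_zero, chebU_one, one_add_one_eq_two] at this
    simp [homogeneousPoly, coeff_C, one_add_one_eq_two]
    linear_combination -this
  | more n h0 h1 =>
    have h2 := chebU_add_one α (n + 2)
    have e1 : ((C (2 * α) * X + C β) * homogeneousPoly α β γ (n + 1)).coeff (1 + (n + 1)) =
        2 * α * chebU α (n + 2) := by
      rw [coeff_mul_add_eq_of_natDegree_le natDegree_linear_le (natDegree_homogeneousPoly_le α β γ (n + 1)),
        h1]
      simp [coeff_C]
      left; congr 1
    have e2 : ((X ^ 2 - C β * X + C γ) * homogeneousPoly α β γ n).coeff (2 + n) =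
        chebU α (n + 1) := by
      rw [coeff_mul_add_eq_of_natDegree_le (by compute_degree) (natDegree_homogeneousPoly_le α β γ n), h0]
      simp
    rw [homogeneousPoly, coeff_sub]
    rw [show n + 2 = 1 + (n + 1) by ring, e1, show 1 + (n + 1) = 2 + n by ring, e2]
    push_cast
    rw [show (2 : ℤ) + n + 1 = n + 2 + 1 by ring, show (n : ℤ) + 1 = n + 2 - 1 by ring]
    linear_combination -h2

theorem homogeneousPoly_eval_mul {α β γ a b z : ℂ} (h1 : a + b = 2 * α * z + β)
    (h2 : a * b = z ^ 2 - β * z + γ) (n : ℕ) :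
    (homogeneousPoly α β γ n).eval z * (a - b) = a ^ (n + 1) - b ^ (n + 1) := by
  induction n using Nat.twoStepInduction with
  | zero => simp [homogeneousPoly]
  | one => simp [homogeneousPoly]; rw [← h1]; ring
  | more n h3 h4 =>
    simp only [homogeneousPoly, eval_sub, eval_add, eval_mul, eval_pow, eval_C, eval_X]
    rw [← h1, ← h2]
    linear_combination (a + b) * h4 - a * b * h3

section DividedDifference

variable {X : ℤ → ℂ} {α β : ℂ}

theorem exists_divided_difference (hX : ∀ i, X (i + 1) + X (i - 1) = 2 * α * X i + β)
    (n : ℕ) (P : ℂ[X]) (hP : P.degree < (n + 1 : ℕ)) :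
    ∃ R : ℂ[X], R.degree < n ∧
      ∀ i, P.eval (X (i + 1)) - P.eval (X (i - 1)) = R.eval (X i) * (X (i + 1) - X (i - 1)) := by
  obtain ⟨γ, hγ⟩ := add_mul_sub_mul_const hX
  refine ⟨∑ j ∈ Finset.range n, C (P.coeff (j + 1)) * homogeneousPoly α β γ j, ?_, fun i => ?_⟩
  · rw [← mem_degreeLT]
    refine Submodule.sum_mem _ fun j hj => ?_
    rw [← smul_eq_C_mul]
    refine Submodule.smul_mem _ _ (mem_degreeLT.2 ?_)
    refine (degree_le_natDegree.trans ?_).trans_lt (Nat.cast_lt.2 (Finset.mem_range.1 hj))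
    exact_mod_cast natDegree_homogeneousPoly_le α β γ j
  · have hd : P.natDegree < n + 1 := by
      by_cases h0 : P = 0
      · simp [h0]
      · exact (natDegree_lt_iff_degree_lt h0).2 hP
    rw [eval_eq_sum_range' hd, eval_eq_sum_range' hd, ← Finset.sum_sub_distrib,
      Finset.sum_range_succ', eval_finsetSum, Finset.sum_mul]
    simp only [pow_zero, sub_self, add_zero, eval_mul, eval_C]
    refine Finset.sum_congr rfl fun j _ => ?_
    rw [mul_assoc, homogeneousPoly_eval_mul (hX i) (hγ i)]
    ring

/-- The divided difference is triangular on monomials, with diagonal entries `chebU α j`; when these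
are nonzero it is inverted from the top degree down. -/
theorem exists_divided_antidifference (hX : ∀ i, X (i + 1) + X (i - 1) = 2 * α * X i + β)
    (n : ℕ) (hn : ∀ j : ℕ, 1 ≤ j → j ≤ n → chebU α j ≠ 0) (R : ℂ[X]) (hR : R.degree < n) :
    ∃ P : ℂ[X], P.degree < (n + 1 : ℕ) ∧
      ∀ i, P.eval (X (i + 1)) - P.eval (X (i - 1)) = R.eval (X i) * (X (i + 1) - X (i - 1)) := by
  obtain ⟨γ, hγ⟩ := add_mul_sub_mul_const hX
  induction n generalizing R with
  | zero =>
    have : R = 0 := by simpa using hR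
    exact ⟨0, by simp, fun i => by simp [this]⟩
  | succ n ih =>
    have hne : chebU α (n + 1) ≠ 0 := by exact_mod_cast hn (n + 1) (by omega) le_rfl
    -- The multiple of X^(n+1) whose divided difference cancels the top coefficient of `R`.
    set r : ℂ := R.coeff n / chebU α (n + 1) with hr
    have hH := natDegree_homogeneousPoly_le α β γ n
    obtain ⟨P, hP, hPR⟩ := ih (fun j h1 h2 => hn j h1 (by omega))
      (R - C r * homogeneousPoly α β γ n) (by
        rw [degree_lt_iff_coeff_zero] at hR ⊢
        intro m hm
        rw [coeff_sub, coeff_C_mul]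
        rcases hm.eq_or_lt with rfl | hm
        · rw [coeff_homogeneousPoly, hr, div_mul_cancel₀ _ hne, sub_self]
        · rw [hR m hm, coeff_eq_zero_of_natDegree_lt (by omega)]
          simp)
    refine ⟨P + C r * Polynomial.X ^ (n + 1), ?_, fun i => ?_⟩
    · refine (degree_add_le _ _).trans_lt (max_lt (hP.trans ?_) ?_)
      · exact_mod_cast Nat.lt_succ_self _
      · refine (degree_C_mul_X_pow_le _ _).trans_lt ?_
        exact_mod_cast Nat.lt_succ_self _
    · have h1 := hPR i
      have h2 := homogeneousPoly_eval_mul (hX i) (hγ i) n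
      simp only [eval_add, eval_sub, eval_mul, eval_C, eval_pow, eval_X] at h1 ⊢
      linear_combination h1 - r * h2

end DividedDifference

/-! ### Difference operators on sequences -/

/-- The operator `Δ_k` in terms of the values `X i = x (N + i / 2)`. -/
noncomputable def seqDelta (X : ℤ → ℂ) (k : ℤ) (f : ℤ → ℂ) (m : ℤ) : ℂ :=
  (f (m + 1) - f m) / (X (2 * m + k + 2) - X (2 * m + k))

/-- The operator `Δ_k^{(n)}` in terms of the values `X i = x (N + i / 2)`. -/
noncomputable def seqDeltaIter (X : ℤ → ℂ) (k : ℤ) : ℕ → (ℤ → ℂ) → ℤ → ℂ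
  | 0, f => f
  | n + 1, f => seqDelta X (k + n) (seqDeltaIter X k n f)

/-- The discrete integral `∑_{i = 0}^{m} h i`, with `∑_{i = 0}^{m} = -∑_{i = m + 1}^{-1}` for
`m < -1`. -/
noncomputable def seqIntegral (h : ℤ → ℂ) (m : ℤ) : ℂ :=
  ∑ i ∈ Finset.Icc 0 m, h i - ∑ i ∈ Finset.Icc (m + 1) (-1), h i

theorem seqIntegral_sub (h : ℤ → ℂ) (m : ℤ) :
    seqIntegral h m - seqIntegral h (m - 1) = h m := by
  unfold seqIntegral
  rw [sub_add_cancel]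
  rcases le_or_gt 0 m with hm | hm
  · rw [Finset.Icc_eq_empty (a := m + 1) (by omega), Finset.Icc_eq_empty (a := m) (by omega),
      show Finset.Icc 0 m = insert m (Finset.Icc 0 (m - 1)) by ext; simp; omega,
      Finset.sum_insert (by simp)]
    simp
  · rw [Finset.Icc_eq_empty (b := m) (by omega), Finset.Icc_eq_empty (b := m - 1) (by omega),
      show Finset.Icc m (-1) = insert m (Finset.Icc (m + 1) (-1)) by ext; simp; omega,
      Finset.sum_insert (by simp)]
    simp

theorem eq_const_of_succ_eq {f : ℤ → ℂ} (hf : ∀ m, f (m + 1) = f m) (m : ℤ) : f m = f 0 := by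
  induction m using Int.induction_on with
  | zero => rfl
  | succ i ih => rw [hf, ih]
  | pred i ih => rw [← ih, ← hf, sub_add_cancel]

section SeqDelta

variable {X : ℤ → ℂ}

theorem seqDelta_linear (k : ℤ) (a b : ℂ) (f g : ℤ → ℂ) :
    seqDelta X k (fun m => a * f m + b * g m) =
      fun m => a * seqDelta X k f m + b * seqDelta X k g m := by
  funext m
  simp only [seqDelta]
  ring

theorem seqDeltaIter_linear (k : ℤ) (n : ℕ) (a b : ℂ) (f g : ℤ → ℂ) :
    seqDeltaIter X k n (fun m => a * f m + b * g m) =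
      fun m => a * seqDeltaIter X k n f m + b * seqDeltaIter X k n g m := by
  induction n with
  | zero => rfl
  | succ n ih =>
    rw [seqDeltaIter, ih, seqDelta_linear]
    rfl

theorem seqDeltaIter_succ (k : ℤ) (n : ℕ) (f : ℤ → ℂ) :
    seqDeltaIter X k (n + 1) f = seqDeltaIter X (k + 1) n (seqDelta X k f) := by
  induction n with
  | zero => simp [seqDeltaIter]
  | succ n ih =>
    rw [seqDeltaIter, ih, seqDeltaIter]
    congr 1
    push_cast
    ring

theorem seqDelta_const (k : ℤ) (c : ℂ) : seqDelta X k (fun _ => c) = fun _ => 0 := by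
  funext m
  simp [seqDelta]

theorem seqDelta_surjective (hw : ∀ i, X (i + 2) - X i ≠ 0) (k : ℤ) :
    Function.Surjective (seqDelta X k) := by
  intro g
  -- The integral inverts the backward difference; evaluating it at m - 1 makes it invert the
  -- forward one.
  refine ⟨fun m => seqIntegral (fun i => g i * (X (2 * i + k + 2) - X (2 * i + k))) (m - 1), ?_⟩
  funext m
  rw [seqDelta, add_sub_cancel_right, seqIntegral_sub, mul_div_cancel_right₀ _ (hw _)]

theorem seqDeltaIter_surjective (hw : ∀ i, X (i + 2) - X i ≠ 0) (k : ℤ) (n : ℕ) :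
    Function.Surjective (seqDeltaIter X k n) := by
  induction n with
  | zero => exact fun g => ⟨g, rfl⟩
  | succ n ih =>
    intro g
    obtain ⟨u, hu⟩ := seqDelta_surjective hw (k + n) g
    obtain ⟨v, hv⟩ := ih u
    exact ⟨v, by rw [seqDeltaIter, hv, hu]⟩

variable {α β : ℂ}

theorem seqDeltaIter_eval (hX : ∀ i, X (i + 1) + X (i - 1) = 2 * α * X i + β)
    (hw : ∀ i, X (i + 2) - X i ≠ 0) (k : ℤ) (n : ℕ) (P : ℂ[X]) (hP : P.degree < n) (m : ℤ) :
    seqDeltaIter X k n (fun m => P.eval (X (2 * m + k))) m = 0 := by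
  induction n generalizing k P with
  | zero =>
    have : P = 0 := by simpa using hP
    simp [seqDeltaIter, this]
  | succ n ih =>
    obtain ⟨R, hR, hPR⟩ := exists_divided_difference hX n P hP
    have : seqDelta X k (fun m => P.eval (X (2 * m + k))) =
        fun m => R.eval (X (2 * m + (k + 1))) := by
      funext m
      have h := hPR (2 * m + (k + 1))
      rw [show 2 * m + (k + 1) + 1 = 2 * m + k + 2 by ring,
        show 2 * m + (k + 1) - 1 = 2 * m + k by ring] at h
      rw [seqDelta, show 2 * (m + 1) + k = 2 * m + k + 2 by ring, h,
        mul_div_cancel_right₀ _ (hw _)]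
    rw [seqDeltaIter_succ, this]
    exact ih (k + 1) R hR

/-- Induction peels off the innermost difference: it is a polynomial in the next lattice, has a
polynomial antidifference, and what remains is a constant. -/
theorem exists_eval_of_seqDeltaIter_eq_zero
    (hX : ∀ i, X (i + 1) + X (i - 1) = 2 * α * X i + β) (hw : ∀ i, X (i + 2) - X i ≠ 0)
    (k : ℤ) (n : ℕ) (hn : ∀ j : ℕ, 1 ≤ j → j < n → chebU α j ≠ 0) (f : ℤ → ℂ)
    (hf : ∀ m, seqDeltaIter X k n f m = 0) :
    ∃ P : ℂ[X], P.degree < n ∧ ∀ m, f m = P.eval (X (2 * m + k)) := by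
  induction n generalizing k f with
  | zero => exact ⟨0, by simp, fun m => by simpa [seqDeltaIter] using hf m⟩
  | succ n ih =>
    rw [seqDeltaIter_succ] at hf
    obtain ⟨R, hR, hfR⟩ := ih (k + 1) (fun j h1 h2 => hn j h1 (by omega)) _ hf
    obtain ⟨P, hP, hPR⟩ :=
      exists_divided_antidifference hX n (fun j h1 h2 => hn j h1 (by omega)) R hR
    have hc := eq_const_of_succ_eq (f := fun m => f m - P.eval (X (2 * m + k))) fun m => by
      have h := hPR (2 * m + (k + 1))
      rw [show 2 * m + (k + 1) + 1 = 2 * m + k + 2 by ring,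
        show 2 * m + (k + 1) - 1 = 2 * m + k by ring, ← hfR, seqDelta,
        div_mul_cancel₀ _ (hw _)] at h
      rw [show 2 * (m + 1) + k = 2 * m + k + 2 by ring]
      linear_combination -h
    refine ⟨P + C (f 0 - P.eval (X (2 * 0 + k))), ?_, fun m => ?_⟩
    · refine (degree_add_le _ _).trans_lt (max_lt hP (degree_C_le.trans_lt ?_))
      exact_mod_cast Nat.succ_pos n
    · rw [eval_add, eval_C, ← hc m]
      ring

end SeqDelta

/-! ### The adjoint equation -/

/-- The first order operator
`v ↦ (σ(s - n) v(s) - (σ(s - 1) + τ(s - 1) ∇ x_1(s - 1)) v(s - 1)) / ∇ x_{-n}(s)`, where `S` and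
`T` hold the values of `σ` and `σ + τ ∇ x_1`. -/
noncomputable def seqAdjoint (X S T : ℤ → ℂ) (n : ℤ) (v : ℤ → ℂ) (m : ℤ) : ℂ :=
  (S (m - n) * v m - T (m - 1) * v (m - 1)) / (X (2 * m - n) - X (2 * m - n - 2))

/-- The function `τ_k`, where `S` and `T` hold the values of `σ` and `σ + τ ∇ x_1`. -/
noncomputable def seqTau (X S T : ℤ → ℂ) (k m : ℤ) : ℂ :=
  (T (m + k) - S m) / (X (2 * m + k + 1) - X (2 * m + k - 1))

section SeqAdjoint

variable {X S T : ℤ → ℂ}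

theorem seqAdjoint_linear (n : ℤ) (a b : ℂ) (f g : ℤ → ℂ) :
    seqAdjoint X S T n (fun m => a * f m + b * g m) =
      fun m => a * seqAdjoint X S T n f m + b * seqAdjoint X S T n g m := by
  funext m
  simp only [seqAdjoint]
  ring

/-- The terms in v(m+1) and v(m-1) agree on both sides; the leftover coefficient of v(m) is exactly
a difference of τ_{n-1}. -/
theorem seqDelta_seqAdjoint (hw : ∀ i, X (i + 2) - X i ≠ 0) (n : ℤ) (v : ℤ → ℂ) (m : ℤ) :
    seqDelta X (-n - 1) (seqAdjoint X S T n v) m =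
      seqAdjoint X S T (n - 1) (seqDelta X (-n) v) m -
        seqDelta X (n - 1) (seqTau X S T (n - 1)) (m - n) * v m := by
  have h1 := hw (2 * m - n)
  have h2 := hw (2 * m - n - 2)
  have h3 := hw (2 * m - n - 1)
  rw [sub_add_cancel] at h2
  rw [show 2 * m - n - 1 + 2 = 2 * m - n + 1 by ring] at h3
  simp only [seqDelta, seqAdjoint, seqTau]
  rw [show 2 * m + (-n - 1) + 2 = 2 * m - n + 1 by ring,
    show 2 * m + (-n - 1) = 2 * m - n - 1 by ring,
    show 2 * (m + 1) - n = 2 * m - n + 2 by ring,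
    show 2 * m - n + 2 - 2 = 2 * m - n by ring,
    show 2 * m + -n = 2 * m - n by ring,
    show 2 * (m - 1) + -n = 2 * m - n - 2 by ring,
    show 2 * m - n - 2 + 2 = 2 * m - n by ring,
    show 2 * m - (n - 1) = 2 * m - n + 1 by ring,
    show 2 * m - n + 1 - 2 = 2 * m - n - 1 by ring,
    show 2 * (m - n + 1) + (n - 1) + 1 = 2 * m - n + 2 by ring,
    show 2 * (m - n + 1) + (n - 1) - 1 = 2 * m - n by ring,
    show 2 * (m - n) + (n - 1) + 1 = 2 * m - n by ring,
    show 2 * (m - n) + (n - 1) - 1 = 2 * m - n - 2 by ring,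
    show 2 * (m - n) + (n - 1) + 2 = 2 * m - n + 1 by ring,
    show 2 * (m - n) + (n - 1) = 2 * m - n - 1 by ring,
    show m - n + 1 + (n - 1) = m by ring, show m - n + (n - 1) = m - 1 by ring,
    show m + 1 - n = m - n + 1 by ring, show m - (n - 1) = m - n + 1 by ring,
    add_sub_cancel_right, sub_add_cancel]
  field_simp
  ring

/-- Each commutation lowers the index of the adjoint by one and releases a constant κ, which passes
through the remaining differences. -/
theorem seqDeltaIter_seqAdjoint (hw : ∀ i, X (i + 2) - X i ≠ 0) {κ : ℕ → ℂ}
    (hκ : ∀ (k : ℕ) (m : ℤ), seqDelta X k (seqTau X S T k) m = κ k) (n : ℕ) (v : ℤ → ℂ) (m : ℤ) :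
    seqDeltaIter X (-n - 2) (n + 1) (seqAdjoint X S T (n + 1) v) m =
      seqAdjoint X S T 0 (seqDeltaIter X (-n - 1) (n + 1) v) m -
        (∑ k ∈ Finset.range (n + 1), κ k) * seqDeltaIter X (-n - 1) n v m := by
  have hstep : ∀ (n : ℕ) (v : ℤ → ℂ), seqDelta X (-n - 2) (seqAdjoint X S T (n + 1) v) =
      fun m => 1 * seqAdjoint X S T n (seqDelta X (-n - 1) v) m + -κ n * v m := by
    intro n v
    funext m
    have h := seqDelta_seqAdjoint (S := S) (T := T) hw (n + 1) v m
    rw [add_sub_cancel_right, hκ, show -((n : ℤ) + 1) - 1 = -n - 2 by ring,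
      show -((n : ℤ) + 1) = -n - 1 by ring] at h
    rw [h]
    ring
  induction n generalizing v m with
  | zero =>
    have h := congrFun (hstep 0 v) m
    simp only [seqDeltaIter_succ]
    simp only [seqDeltaIter]
    rw [h]
    simp
    ring
  | succ n ih =>
    rw [seqDeltaIter_succ, hstep, seqDeltaIter_linear]
    have h := ih (seqDelta X (-n - 2) v) m
    push_cast
    rw [Finset.sum_range_succ, seqDeltaIter_succ (-((n : ℤ) + 1) - 1) (n + 1),
      seqDeltaIter_succ (-((n : ℤ) + 1) - 1) n,
      show -((n : ℤ) + 1) - 2 + 1 = -n - 2 by ring,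
      show -((n : ℤ) + 1) - 1 = -n - 2 by ring, show -(n : ℤ) - 2 + 1 = -n - 1 by ring, h]
    rw [show seqDeltaIter X (-n - 2) (n + 1) v m =
      seqDeltaIter X (-n - 1) n (seqDelta X (-n - 2) v) m by
        rw [seqDeltaIter_succ, show -(n : ℤ) - 2 + 1 = -n - 1 by ring]]
    ring

end SeqAdjoint

/-! ### The Pearson equation and the solution formula -/

/-- The hypergeometric type operator in terms of the values `X i = x (N + i / 2)`, where `S` and `T`
hold the values of `σ` and `σ + τ ∇ x_1`. -/
noncomputable def seqHypergeometric (X S T : ℤ → ℂ) (lam : ℂ) (y : ℤ → ℂ) (m : ℤ) : ℂ :=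
  (T m * ((y (m + 1) - y m) / (X (2 * m + 2) - X (2 * m))) -
      S m * ((y m - y (m - 1)) / (X (2 * m) - X (2 * m - 2)))) /
    (X (2 * m + 1) - X (2 * m - 1)) + lam * y m

/-- The sequence `ρ(s) ∏_{j=0}^{n-1} σ(s - j)`. -/
noncomputable def seqWeight (S r : ℤ → ℂ) (n : ℕ) (m : ℤ) : ℂ :=
  r m * ∏ j ∈ Finset.range n, S (m - j)

section Pearson

variable {X S T r : ℤ → ℂ}

theorem mul_seqHypergeometric (hr : ∀ m, S (m + 1) * r (m + 1) = T m * r m) (lam : ℂ)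
    (y : ℤ → ℂ) (m : ℤ) :
    r m * seqHypergeometric X S T lam y m =
      seqDelta X (-1) (seqAdjoint X S T 0 (fun m => r m * y m)) m + lam * (r m * y m) := by
  have h1 := hr m
  have h2 := hr (m - 1)
  rw [sub_add_cancel] at h2
  simp only [seqHypergeometric, seqDelta, seqAdjoint, sub_zero, add_sub_cancel_right]
  rw [show 2 * (m + 1) - 2 = 2 * m by ring, show 2 * (m + 1) = 2 * m + 2 by ring,
    show 2 * m + -1 + 2 = 2 * m + 1 by ring, show 2 * m + -1 = 2 * m - 1 by ring]
  have e1 : S (m + 1) * (r (m + 1) * y (m + 1)) - T m * (r m * y m) =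
      r m * (T m * (y (m + 1) - y m)) := by linear_combination y (m + 1) * h1
  have e2 : S m * (r m * y m) - T (m - 1) * (r (m - 1) * y (m - 1)) =
      r m * (S m * (y m - y (m - 1))) := by linear_combination y (m - 1) * h2
  rw [e1, e2]
  ring

theorem seqWeight_ne_zero (hS : ∀ m, S m ≠ 0) (hr0 : ∀ m, r m ≠ 0) (n : ℕ) (m : ℤ) :
    seqWeight S r n m ≠ 0 :=
  mul_ne_zero (hr0 m) (Finset.prod_ne_zero_iff.2 fun _ _ => hS _)

theorem seqWeight_succ (n : ℕ) (m : ℤ) :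
    seqWeight S r (n + 1) m = seqWeight S r n m * S (m - n) := by
  rw [seqWeight, Finset.prod_range_succ, seqWeight, mul_assoc]

theorem seqWeight_succ_eq_mul (hr : ∀ m, S (m + 1) * r (m + 1) = T m * r m) (n : ℕ) (m : ℤ) :
    seqWeight S r (n + 1) m = T (m - 1) * seqWeight S r n (m - 1) := by
  have h := hr (m - 1)
  rw [sub_add_cancel] at h
  rw [seqWeight, Finset.prod_range_succ', seqWeight]
  simp only [Nat.cast_add, Nat.cast_one, Nat.cast_zero, sub_zero, sub_sub, add_comm (1 : ℤ)]
  linear_combination (∏ j ∈ Finset.range n, S (m - (j + 1))) * h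

/-- Variation of constants. The two expressions for `seqWeight S r (n + 1)` show that `seqWeight S r
n` solves the homogeneous equation, so the quotient of v by it has a prescribed backward difference.
-/
theorem seqAdjoint_eq_iff (hw : ∀ i, X (i + 2) - X i ≠ 0) (hS : ∀ m, S m ≠ 0)
    (hr0 : ∀ m, r m ≠ 0) (hr : ∀ m, S (m + 1) * r (m + 1) = T m * r m) (n : ℕ) (v p : ℤ → ℂ) :
    (∀ m, seqAdjoint X S T n v m = p m) ↔
      ∃ c : ℂ, ∀ m, v m = seqWeight S r n m * (c + seqIntegral
        (fun m => p m / seqWeight S r (n + 1) m * (X (2 * m - n) - X (2 * m - n - 2))) m) := by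
  have hW := seqWeight_ne_zero hS hr0
  set h : ℤ → ℂ :=
    fun m => p m / seqWeight S r (n + 1) m * (X (2 * m - n) - X (2 * m - n - 2)) with hh
  have key : ∀ m, seqAdjoint X S T n v m = p m ↔
      v m / seqWeight S r n m - v (m - 1) / seqWeight S r n (m - 1) = h m := by
    intro m
    have hw' := hw (2 * m - n - 2)
    rw [sub_add_cancel] at hw'
    have e : seqWeight S r (n + 1) m *
        (v m / seqWeight S r n m - v (m - 1) / seqWeight S r n (m - 1)) =
        S (m - n) * v m - T (m - 1) * v (m - 1) := by
      rw [mul_sub]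
      nth_rewrite 1 [seqWeight_succ]
      rw [seqWeight_succ_eq_mul hr]
      have h1 := hW n m
      have h2 := hW n (m - 1)
      field_simp
    simp only [hh]
    rw [seqAdjoint, ← e, div_eq_iff hw', div_mul_eq_mul_div, eq_div_iff (hW _ _), mul_comm]
  simp only [key]
  constructor
  · intro hv
    refine ⟨v 0 / seqWeight S r n 0 - seqIntegral h 0, fun m => ?_⟩
    have hc := eq_const_of_succ_eq (f := fun m => v m / seqWeight S r n m - seqIntegral h m)
      (fun m => by
        have h1 := hv (m + 1)
        have h2 := seqIntegral_sub h (m + 1)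
        rw [add_sub_cancel_right] at h1 h2
        linear_combination h1 - h2) m
    have h1 := hW n m
    rw [← hc, sub_add_cancel, mul_div_cancel₀ _ h1]
  · rintro ⟨c, hc⟩ m
    rw [hc m, hc (m - 1), mul_div_cancel_left₀ _ (hW _ _), mul_div_cancel_left₀ _ (hW _ _),
      ← seqIntegral_sub h m]
    ring

variable {α β : ℂ}

theorem seqHypergeometric_eq_zero_iff
    (hX : ∀ i, X (i + 1) + X (i - 1) = 2 * α * X i + β) (hw : ∀ i, X (i + 2) - X i ≠ 0)
    (hS : ∀ m, S m ≠ 0) (hr0 : ∀ m, r m ≠ 0) (hr : ∀ m, S (m + 1) * r (m + 1) = T m * r m)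
    {κ : ℕ → ℂ} (hκ : ∀ (k : ℕ) (m : ℤ), seqDelta X k (seqTau X S T k) m = κ k)
    (n : ℕ) (hn : 1 ≤ n) (hα : ∀ j : ℕ, 1 ≤ j → j ≤ n → chebU α j ≠ 0)
    (hlam : ∑ k ∈ Finset.range n, κ k ≠ 0) (y : ℤ → ℂ) :
    (∀ m, seqHypergeometric X S T (-∑ k ∈ Finset.range n, κ k) y m = 0) ↔
      ∃ (c : ℂ) (P : ℂ[X]), P.degree = n ∧ ∀ m,
        y m = c / r m * seqDeltaIter X (-n) n (seqWeight S r n) m +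
          1 / r m * seqDeltaIter X (-n) n (fun u => seqWeight S r n u * seqIntegral
            (fun t => P.eval (X (2 * t - (n + 1))) / seqWeight S r (n + 1) t *
              (X (2 * t - n) - X (2 * t - n - 2))) u) m := by
  obtain ⟨n, rfl⟩ : ∃ l, n = l + 1 := ⟨n - 1, by omega⟩
  set Λ := ∑ k ∈ Finset.range (n + 1), κ k with hΛ
  have hiter := seqDeltaIter_seqAdjoint hw hκ n
  have c1 : ((n + 1 : ℕ) : ℤ) = n + 1 := by push_cast; rfl
  have e1 : -((n + 1 : ℕ) : ℤ) = -n - 1 := by push_cast; ring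
  have e2 : ∀ m : ℤ, 2 * m - (((n + 1 : ℕ) : ℤ) + 1) = 2 * m + (-n - 2) := fun m => by
    push_cast; ring
  -- One further difference turns the iterated commutation into the hypergeometric operator, because
  -- the outermost Δ_{-1} of the last term restores r y.
  have hfac : ∀ v : ℤ → ℂ, (∀ m, r m * y m = seqDeltaIter X (-n - 1) (n + 1) v m) →
      ∀ m, seqDeltaIter X (-n - 2) (n + 2) (seqAdjoint X S T (n + 1) v) m =
        r m * seqHypergeometric X S T (-Λ) y m := by
    intro v hv m
    have h1 : seqDeltaIter X (-n - 2) (n + 1) (seqAdjoint X S T (n + 1) v) =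
        fun m => 1 * seqAdjoint X S T 0 (fun m => r m * y m) m +
          -Λ * seqDeltaIter X (-n - 1) n v m := by
      funext m
      rw [hiter, ← funext hv, one_mul, neg_mul, sub_eq_add_neg]
    rw [seqDeltaIter, h1, seqDelta_linear, mul_seqHypergeometric hr, hv, seqDeltaIter, c1,
      show -(n : ℤ) - 2 + (n + 1) = -1 by ring, show -(n : ℤ) - 1 + n = -1 by ring]
    simp only [one_mul]
  have hsol : ∀ (c : ℂ) (v I : ℤ → ℂ) (m : ℤ),
      (∀ m, v m = seqWeight S r (n + 1) m * (c + I m)) →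
      (y m = c / r m * seqDeltaIter X (-n - 1) (n + 1) (seqWeight S r (n + 1)) m +
          1 / r m * seqDeltaIter X (-n - 1) (n + 1)
            (fun u => seqWeight S r (n + 1) u * I u) m ↔
        r m * y m = seqDeltaIter X (-n - 1) (n + 1) v m) := by
    intro c v I m hv
    have h1 : v = fun m => c * seqWeight S r (n + 1) m + 1 * (seqWeight S r (n + 1) m * I m) := by
      funext m
      rw [hv]
      ring
    have h2 := hr0 m
    rw [h1, seqDeltaIter_linear]
    field_simp
  rw [e1]
  simp only [e2]
  constructor
  · intro hy
    obtain ⟨v₀, hv₀⟩ := seqDeltaIter_surjective hw (-n - 1) (n + 1) (fun m => r m * y m)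
    -- Adding `q` to v leaves y unchanged but shifts the top difference of the adjoint by -Λ ≠ 0,
    -- which secures the exact degree.
    obtain ⟨q, hq⟩ := seqDeltaIter_surjective hw (-n - 1) n (fun _ => 1)
    have hq1 : seqDeltaIter X (-n - 1) (n + 1) q = fun _ => 0 := by
      rw [seqDeltaIter, hq, seqDelta_const]
    obtain ⟨v, hv, hv1⟩ : ∃ v : ℤ → ℂ, (∀ m, r m * y m = seqDeltaIter X (-n - 1) (n + 1) v m) ∧
        seqDeltaIter X (-n - 2) (n + 1) (seqAdjoint X S T (n + 1) v) 0 ≠ 0 := by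
      have hq2 : seqDeltaIter X (-n - 2) (n + 1) (seqAdjoint X S T (n + 1) q) 0 = -Λ := by
        rw [hiter, hq1, hq]
        simp [seqAdjoint, hΛ]
      by_cases h0 : seqDeltaIter X (-n - 2) (n + 1) (seqAdjoint X S T (n + 1) v₀) 0 = 0
      · refine ⟨fun m => 1 * v₀ m + 1 * q m, fun m => ?_, ?_⟩
        · rw [seqDeltaIter_linear, hv₀, hq1]
          ring
        · rw [seqAdjoint_linear, seqDeltaIter_linear]
          simp only [h0, hq2]
          simpa using hlam
      · exact ⟨v₀, fun m => (congrFun hv₀ m).symm, h0⟩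
    obtain ⟨P, hP, hvP⟩ := exists_eval_of_seqDeltaIter_eq_zero hX hw (-n - 2) (n + 2)
      (fun j h1 h2 => hα j h1 (by omega)) (seqAdjoint X S T (n + 1) v)
      (fun m => by rw [hfac v hv, hy, mul_zero])
    have hdeg : P.degree = (n + 1 : ℕ) := by
      refine le_antisymm ?_ (not_lt.1 fun h => hv1 ?_)
      · exact (degree_le_iff_coeff_zero _ _).2 fun j hj =>
          (degree_lt_iff_coeff_zero _ _).1 hP j (Nat.cast_lt.1 hj)
      · rw [funext hvP]
        exact seqDeltaIter_eval hX hw _ _ _ h 0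
    obtain ⟨c, hc⟩ := (seqAdjoint_eq_iff hw hS hr0 hr (n + 1) v _).1 (by simpa using hvP)
    exact ⟨c, P, hdeg, fun m => (hsol c v _ m hc).2 (hv m)⟩
  · rintro ⟨c, P, hdeg, hy⟩ m
    set v : ℤ → ℂ := fun m => seqWeight S r (n + 1) m * (c + seqIntegral
      (fun t => P.eval (X (2 * t + (-n - 2))) / seqWeight S r (n + 1 + 1) t *
        (X (2 * t - (n + 1 : ℕ)) - X (2 * t - (n + 1 : ℕ) - 2))) m) with hv
    have hvy : ∀ m, r m * y m = seqDeltaIter X (-n - 1) (n + 1) v m :=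
      fun m => (hsol c v _ m fun m => rfl).1 (hy m)
    have hvP := (seqAdjoint_eq_iff hw hS hr0 hr (n + 1) v
      (fun m => P.eval (X (2 * m + (-n - 2))))).2 ⟨c, fun m => rfl⟩
    have h := hfac v hvy m
    rw [c1] at hvP
    rw [funext hvP, seqDeltaIter_eval hX hw _ _ _ (by rw [hdeg]; exact_mod_cast Nat.lt_succ_self _)]
      at h
    exact (mul_eq_zero.1 h.symm).resolve_left (hr0 m)

end Pearson

/-! ### The function `τ_k` -/

theorem chebU_two_mul (α : ℂ) (k : ℕ) :
    chebU α (2 * k) = 2 * chebT α k * chebU α k := by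
  have h := add_eq_chebT_mul (X := chebU α) (chebU_add_one α) k k
  rwa [sub_self, chebU_zero, add_zero, ← two_mul] at h

theorem chebT_two_mul (α : ℂ) (k : ℕ) :
    chebT α (2 * k) = chebT α k ^ 2 + (α ^ 2 - 1) * chebU α k ^ 2 := by
  have h := add_eq_chebT_mul (X := chebT α) (chebT_add_one α) k k
  have h' := sub_eq_chebU_mul (X := chebT α) (β := 0) (by simpa using chebT_add_one α) k k
  rw [sub_self, chebT_zero, ← two_mul] at h h'
  have h1 := chebU_add_one_eq α k
  have h2 := chebU_add_one_eq α (k + 1)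
  have h3 := chebU_add_one α (k + 1)
  have h4 := chebT_add_one α k
  rw [add_sub_cancel_right] at h3
  linear_combination h / 2 + h' / 2 - chebU α k * (h2 - h3 + h4 / 2 - α * h1)

theorem exists_seqTau_eq {X S T : ℤ → ℂ} {α β a b c d e : ℂ}
    (hX : ∀ i, X (i + 1) + X (i - 1) = 2 * α * X i + β) (hw : ∀ i, X (i + 2) - X i ≠ 0)
    (hS : ∀ m, S m = a * X (2 * m) ^ 2 + b * X (2 * m) + c -
      (d * X (2 * m) + e) * (X (2 * m + 1) - X (2 * m - 1)) / 2)
    (hT : ∀ m, T m = a * X (2 * m) ^ 2 + b * X (2 * m) + c +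
      (d * X (2 * m) + e) * (X (2 * m + 1) - X (2 * m - 1)) / 2) (k : ℕ) :
    ∃ z : ℂ, ∀ m, seqTau X S T k m =
      (a * chebU α (2 * k) + d * chebT α (2 * k)) * X (2 * m + k) + z := by
  obtain ⟨b', hb'⟩ := exists_add_eq_chebT_mul hX k
  have hd := sub_eq_chebU_mul hX k
  refine ⟨a * chebU α k * b' + b * chebU α k + d * (chebT α k * b' / 2 +
    chebU α k ^ 2 * β * (α + 1) / 2) + e * chebT α k, fun m => ?_⟩
  rw [chebU_two_mul, chebT_two_mul, seqTau, hS, hT]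
  have hw' := hw (2 * m + k - 1)
  rw [show 2 * m + (k : ℤ) - 1 + 2 = 2 * m + k + 1 by ring] at hw'
  rw [div_eq_iff hw']
  -- The points 2(m+k) and 2m lie symmetrically about j. With A, B the values of X there and wA, wB
  -- the steps around them, each of A - B, wA + wB and A wA + B wB is w times an affine function of
  -- X j; hence the quotient is affine.
  set j : ℤ := 2 * m + k with hj
  rw [show 2 * (m + (k : ℤ)) = j + k by rw [hj]; ring, show 2 * m = j - k by rw [hj]; ring,
    show j + (k : ℤ) + 1 = j + 1 + k by ring, show j + (k : ℤ) - 1 = j - 1 + k by ring,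
    show j - (k : ℤ) + 1 = j + 1 - k by ring, show j - (k : ℤ) - 1 = j - 1 - k by ring]
  have s0 := hb' j
  have s1 := hb' (j + 1)
  have s2 := hb' (j - 1)
  have d0 := hd j
  have d1 := hd (j + 1)
  have d2 := hd (j - 1)
  have x0 := hX j
  have x1 := hX (j + 1)
  have x2 := hX (j - 1)
  rw [add_sub_cancel_right] at d1 x1
  rw [sub_add_cancel] at d2 x2
  set w := X (j + 1) - X (j - 1) with hwdef
  have hV : X (j + 1 + 1) - X j - (X j - X (j - 1 - 1)) =
      4 * ((α ^ 2 - 1) * X j + β * (α + 1) / 2) := by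
    linear_combination x1 + x2 + 2 * α * x0
  have hA : X (j + k) = (2 * chebT α k * X j + b' + chebU α k * w) / 2 := by
    linear_combination (s0 + d0) / 2
  have hB : X (j - k) = (2 * chebT α k * X j + b' - chebU α k * w) / 2 := by
    linear_combination (s0 - d0) / 2
  have hwA : X (j + 1 + k) - X (j - 1 + k) = (2 * chebT α k * w +
      chebU α k * (4 * ((α ^ 2 - 1) * X j + β * (α + 1) / 2))) / 2 := by
    linear_combination (s1 - s2 + d1 - d2) / 2 + chebU α k / 2 * hV
  have hwB : X (j + 1 - k) - X (j - 1 - k) = (2 * chebT α k * w -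
      chebU α k * (4 * ((α ^ 2 - 1) * X j + β * (α + 1) / 2))) / 2 := by
    linear_combination (s1 - s2 - d1 + d2) / 2 - chebU α k / 2 * hV
  rw [hwA, hwB, hA, hB]
  ring

theorem seqDelta_seqTau {X S T : ℤ → ℂ} {α β a b c d e : ℂ}
    (hX : ∀ i, X (i + 1) + X (i - 1) = 2 * α * X i + β) (hw : ∀ i, X (i + 2) - X i ≠ 0)
    (hS : ∀ m, S m = a * X (2 * m) ^ 2 + b * X (2 * m) + c -
      (d * X (2 * m) + e) * (X (2 * m + 1) - X (2 * m - 1)) / 2)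
    (hT : ∀ m, T m = a * X (2 * m) ^ 2 + b * X (2 * m) + c +
      (d * X (2 * m) + e) * (X (2 * m + 1) - X (2 * m - 1)) / 2) (k : ℕ) (m : ℤ) :
    seqDelta X k (seqTau X S T k) m = a * chebU α (2 * k) + d * chebT α (2 * k) := by
  obtain ⟨z, hz⟩ := exists_seqTau_eq hX hw hS hT k
  rw [seqDelta, hz, hz, div_eq_iff (hw _), show 2 * (m + 1) + (k : ℤ) = 2 * m + k + 2 by ring]
  ring

/-- If `U_{j-1}(α) = 0`, then `λ_n = λ_{n-j}`. -/
theorem sum_slope_eq_of_chebU_eq_zero (α a d : ℂ) {n j : ℕ} (hjn : j ≤ n)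
    (hj : chebU α j = 0) :
    ∑ k ∈ Finset.range (n - j), (a * chebU α (2 * k) + d * chebT α (2 * k)) =
      ∑ k ∈ Finset.range n, (a * chebU α (2 * k) + d * chebT α (2 * k)) := by
  obtain ⟨m, rfl⟩ := Nat.exists_eq_add_of_le' hjn
  -- The slopes are the even-indexed terms of a solution of the homogeneous recurrence, so the last
  -- j of them sum to a multiple of `chebU α j`.
  have h := sum_eq_chebU_mul (X := fun i => a * chebU α i + d * chebT α i) (α := α)
    (fun i => by linear_combination a * chebU_add_one α i + d * chebT_add_one α i) m j
  rw [hj, zero_mul] at h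
  rw [Nat.add_sub_cancel, Finset.sum_range_add]
  push_cast
  rw [h, add_zero]

/-! ### Restriction to the lattice points -/

/-- The values of a lattice function at the points `N + i / 2`. -/
noncomputable def latticeSeq (x : ℂ → ℂ) (N : ℂ) (i : ℤ) : ℂ := x (N + i / 2)

/-- Half-steps multiply the exponentials by q^(±1/2), so α is the mean of these two factors; a
quadratic has constant second difference, so α = 1. -/
theorem IsNonuniformLattice.exists_recurrence {x : ℂ → ℂ} (hx : IsNonuniformLattice x) (N : ℂ) :
    ∃ α β : ℂ, ∀ i, latticeSeq x N (i + 1) + latticeSeq x N (i - 1) =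
      2 * α * latticeSeq x N i + β := by
  rcases hx with ⟨q, c₁, c₂, c₃, hq, -, -, hx⟩ | ⟨c₁, c₂, c₃, -, hx⟩
  · refine ⟨(q ^ (1 / 2 : ℂ) + q ^ (-(1 / 2) : ℂ)) / 2,
      2 * c₃ - (q ^ (1 / 2 : ℂ) + q ^ (-(1 / 2) : ℂ)) * c₃, fun i => ?_⟩
    simp only [latticeSeq, hx]
    push_cast
    rw [show N + ((i : ℂ) + 1) / 2 = N + i / 2 + 1 / 2 by ring,
      show N + ((i : ℂ) - 1) / 2 = N + i / 2 + -(1 / 2) by ring,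
      show -(N + (i : ℂ) / 2 + 1 / 2) = -(N + i / 2) + -(1 / 2) by ring,
      show -(N + (i : ℂ) / 2 + -(1 / 2)) = -(N + i / 2) + 1 / 2 by ring]
    simp only [Complex.cpow_add _ _ hq]
    ring
  · refine ⟨1, c₁ / 2, fun i => ?_⟩
    simp only [latticeSeq, hx]
    push_cast
    ring

section Restriction

variable (x : ℂ → ℂ) (N : ℂ)

theorem forwardDiff_shiftedLattice (k m : ℤ) : forwardDiff (shiftedLattice x k) (N + m) =
    latticeSeq x N (2 * m + k + 2) - latticeSeq x N (2 * m + k) := by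
  simp only [forwardDiff, shiftedLattice, latticeSeq]
  push_cast
  congr 2 <;> ring

theorem backwardDiff_shiftedLattice (k m : ℤ) : backwardDiff (shiftedLattice x k) (N + m) =
    latticeSeq x N (2 * m + k) - latticeSeq x N (2 * m + k - 2) := by
  simp only [backwardDiff, shiftedLattice, latticeSeq]
  push_cast
  congr 2 <;> ring

theorem deltaOp_eq_seqDelta (k : ℤ) (f : ℂ → ℂ) (m : ℤ) :
    deltaOp x k f (N + m) = seqDelta (latticeSeq x N) k (fun m => f (N + m)) m := by
  rw [deltaOp, forwardDiff_shiftedLattice, seqDelta, forwardDiff]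
  push_cast
  rw [add_assoc]

theorem deltaIter_eq_seqDeltaIter (k : ℤ) (n : ℕ) (f : ℂ → ℂ) (m : ℤ) :
    deltaIter x k n f (N + m) = seqDeltaIter (latticeSeq x N) k n (fun m => f (N + m)) m := by
  induction n generalizing m with
  | zero => rfl
  | succ n ih => rw [deltaIter, deltaOp_eq_seqDelta, seqDeltaIter, funext ih]

theorem nablaIntegral_eq_seqIntegral (k m : ℤ) (g : ℂ → ℂ) :
    nablaIntegral x k N (N + m) g = seqIntegral (fun i => g (N + i) *
      (latticeSeq x N (2 * i + k) - latticeSeq x N (2 * i + k - 2))) m := by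
  simp only [nablaIntegral, seqIntegral, backwardDiff_shiftedLattice, add_sub_cancel_left,
    Complex.intCast_re, Int.floor_intCast]

variable (σt τt : ℂ[X])

/-- The values of `σ` at the lattice points. -/
noncomputable def sigmaSeq (m : ℤ) : ℂ := sigmaFun x σt τt (N + m)

/-- The values of `σ + τ ∇ x_1` at the lattice points. -/
noncomputable def sigmaTauSeq (m : ℤ) : ℂ := sigmaFun x σt τt (N + m) +
  tauFun x τt (N + m) * backwardDiff (shiftedLattice x 1) (N + m)

theorem sigmaSeq_eq (m : ℤ) : sigmaSeq x N σt τt m = σt.eval (latticeSeq x N (2 * m)) -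
    τt.eval (latticeSeq x N (2 * m)) *
      (latticeSeq x N (2 * m + 1) - latticeSeq x N (2 * m - 1)) / 2 := by
  rw [sigmaSeq, sigmaFun, backwardDiff_shiftedLattice,
    show 2 * m + 1 - 2 = 2 * m - 1 by ring, show x (N + m) = latticeSeq x N (2 * m) by
      rw [latticeSeq]; push_cast; congr 2; ring]
  ring

theorem sigmaTauSeq_eq (m : ℤ) : sigmaTauSeq x N σt τt m = σt.eval (latticeSeq x N (2 * m)) +
    τt.eval (latticeSeq x N (2 * m)) *
      (latticeSeq x N (2 * m + 1) - latticeSeq x N (2 * m - 1)) / 2 := by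
  rw [sigmaTauSeq, ← sigmaSeq, sigmaSeq_eq, tauFun, backwardDiff_shiftedLattice,
    show 2 * m + 1 - 2 = 2 * m - 1 by ring, show x (N + m) = latticeSeq x N (2 * m) by
      rw [latticeSeq]; push_cast; congr 2; ring]
  ring

theorem tauSeq_eq_seqTau (k m : ℤ) : tauSeq x σt τt k (N + m) =
    seqTau (latticeSeq x N) (sigmaSeq x N σt τt) (sigmaTauSeq x N σt τt) k m := by
  rw [tauSeq, seqTau, backwardDiff_shiftedLattice x N, sigmaSeq, sigmaTauSeq]
  push_cast
  rw [show 2 * m + (k + 1) - 2 = 2 * m + k - 1 by ring, ← add_assoc, ← add_assoc]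
  ring

theorem weightProd_eq_seqWeight (ρ : ℂ → ℂ) (n : ℕ) (m : ℤ) :
    weightProd x σt τt ρ n (N + m) =
      seqWeight (sigmaSeq x N σt τt) (fun m => ρ (N + m)) n m := by
  simp only [weightProd, seqWeight, sigmaSeq]
  push_cast
  simp only [add_sub_assoc]

variable {x N}

/-- Collecting Δ_0 y and ∇_0 y over the common denominator ∇x_1 gives them the coefficients σ̃ ± τ̃
∇x_1 / 2, which are `sigmaTauSeq` and `sigmaSeq`. -/
theorem hypergeometricOp_eq_seqHypergeometric
    (hw : ∀ i, latticeSeq x N (i + 2) - latticeSeq x N i ≠ 0) (lam : ℂ) (y : ℂ → ℂ) (m : ℤ) :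
    hypergeometricOp x σt τt lam y (N + m) =
      seqHypergeometric (latticeSeq x N) (sigmaSeq x N σt τt) (sigmaTauSeq x N σt τt) lam
        (fun m => y (N + m)) m := by
  have hnabla : ∀ m : ℤ, nablaOp x 0 y (N + m) = (y (N + m) - y (N + (m - 1 : ℤ))) /
      (latticeSeq x N (2 * m) - latticeSeq x N (2 * m - 2)) := fun m => by
    rw [nablaOp, backwardDiff_shiftedLattice, backwardDiff, add_zero]
    push_cast
    rw [add_sub_assoc]
  have hw' := hw (2 * m - 1)
  rw [show 2 * m - 1 + 2 = 2 * m + 1 by ring] at hw'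
  rw [hypergeometricOp, deltaOp_eq_seqDelta, deltaOp_eq_seqDelta, seqDelta, seqDelta, hnabla,
    hnabla, seqHypergeometric, sigmaSeq_eq, sigmaTauSeq_eq,
    show x (N + m) = latticeSeq x N (2 * m) by rw [latticeSeq]; push_cast; congr 2; ring,
    add_sub_cancel_right, add_zero, show 2 * (m + 1) - 2 = 2 * m by ring,
    show 2 * (m + 1) = 2 * m + 2 by ring, show 2 * m + -1 + 2 = 2 * m + 1 by ring,
    show 2 * m + -1 = 2 * m - 1 by ring]
  generalize (y (N + (m + 1 : ℤ)) - y (N + m)) /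
    (latticeSeq x N (2 * m + 2) - latticeSeq x N (2 * m)) = A
  generalize (y (N + m) - y (N + (m - 1 : ℤ))) /
    (latticeSeq x N (2 * m) - latticeSeq x N (2 * m - 2)) = B
  field_simp
  ring

end Restriction

theorem mainTheorem2 (x : ℂ → ℂ) (hx : IsNonuniformLattice x)
    (σt τt : ℂ[X]) (hσt : σt.natDegree ≤ 2) (hτt : τt.natDegree ≤ 1)
    (N : ℂ)
    (hstep : ∀ s ∈ latticePoints N, ∀ k : ℤ, forwardDiff (shiftedLattice x k) s ≠ 0)
    (hσ : ∀ s ∈ latticePoints N, sigmaFun x σt τt s ≠ 0)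
    (ρ : ℂ → ℂ)
    (hρ : ∀ s ∈ latticePoints N, ρ s ≠ 0)
    (hpearson : ∀ s ∈ latticePoints N, PearsonAt x σt τt ρ s)
    (n : ℕ) (hn : 1 ≤ n) (lam : ℂ)
    (hlam : lam = lambdaSeq x σt τt n N)
    (hne : ∀ m : ℕ, m < n → lambdaSeq x σt τt m N ≠ lambdaSeq x σt τt n N)
    (y : ℂ → ℂ) :
    (∀ s ∈ latticePoints N, hypergeometricOp x σt τt lam y s = 0) ↔
      ∃ (C : ℂ) (P : ℂ[X]), P.degree = (n : WithBot ℕ) ∧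
        ∀ s ∈ latticePoints N,
          y s = C / ρ s * deltaIter x (-(n : ℤ)) n (weightProd x σt τt ρ n) s
            + 1 / ρ s * deltaIter x (-(n : ℤ)) n
                (fun u => weightProd x σt τt ρ n u *
                  nablaIntegral x (-(n : ℤ)) N u
                    (fun t => P.eval (shiftedLattice x (-((n : ℤ) + 1)) t) /
                      weightProd x σt τt ρ (n + 1) t)) s := by
  have hforall : ∀ p : ℂ → Prop, (∀ s ∈ latticePoints N, p s) ↔ ∀ m : ℤ, p (N + m) :=
    fun p => ⟨fun h m => h _ ⟨m, rfl⟩, by rintro h _ ⟨m, rfl⟩; exact h m⟩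
  simp only [hforall] at hstep hσ hρ hpearson ⊢
  obtain ⟨α, β, hX⟩ := hx.exists_recurrence N
  -- Varying k at the single point N already reaches every step, at integer and half-integer
  -- positions.
  have hw : ∀ i, latticeSeq x N (i + 2) - latticeSeq x N i ≠ 0 := fun i => by
    have h := hstep 0 i
    rwa [forwardDiff_shiftedLattice, mul_zero, zero_add] at h
  have hr : ∀ m : ℤ, sigmaSeq x N σt τt (m + 1) * ρ (N + (m + 1 : ℤ)) =
      sigmaTauSeq x N σt τt m * ρ (N + m) := fun m => by
    have h := hpearson m
    have hw' := hw (2 * m + -1)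
    rw [PearsonAt, deltaOp_eq_seqDelta, seqDelta, div_eq_iff hw',
      show 2 * m + -1 + 2 = 2 * m + 1 by ring, show 2 * m + -1 = 2 * m + 1 - 2 by ring,
      ← backwardDiff_shiftedLattice] at h
    rw [sigmaSeq, sigmaTauSeq]
    linear_combination h
  have hslope : ∀ (k : ℕ) (m : ℤ), seqDelta (latticeSeq x N) k
      (seqTau (latticeSeq x N) (sigmaSeq x N σt τt) (sigmaTauSeq x N σt τt) k) m =
      σt.coeff 2 * chebU α (2 * k) + τt.coeff 1 * chebT α (2 * k) := by
    have e1 : ∀ z, σt.eval z = σt.coeff 2 * z ^ 2 + σt.coeff 1 * z + σt.coeff 0 := fun z => by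
      rw [eval_eq_sum_range' (Nat.lt_succ_of_le hσt)]
      simp only [Finset.sum_range_succ, Finset.sum_range_zero]
      ring
    have e2 : ∀ z, τt.eval z = τt.coeff 1 * z + τt.coeff 0 := fun z => by
      rw [eval_eq_sum_range' (Nat.lt_succ_of_le hτt)]
      simp only [Finset.sum_range_succ, Finset.sum_range_zero]
      ring
    refine seqDelta_seqTau hX hw (b := σt.coeff 1) (c := σt.coeff 0) (e := τt.coeff 0)
      (fun m => ?_) (fun m => ?_)
    · rw [sigmaSeq_eq, e1, e2]
    · rw [sigmaTauSeq_eq, e1, e2]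
  have hlambda : ∀ j : ℕ, lambdaSeq x σt τt j N = -∑ k ∈ Finset.range j,
      (σt.coeff 2 * chebU α (2 * k) + τt.coeff 1 * chebT α (2 * k)) := fun j => by
    rw [lambdaSeq]
    congr 1
    refine Finset.sum_congr rfl fun k _ => ?_
    have h := deltaOp_eq_seqDelta x N k (tauSeq x σt τt k) 0
    rw [Int.cast_zero, add_zero] at h
    rw [h, ← hslope k 0]
    simp only [tauSeq_eq_seqTau]
  simp only [hlambda] at hlam hne
  have hα : ∀ j : ℕ, 1 ≤ j → j ≤ n → chebU α j ≠ 0 := fun j h1 h2 h3 =>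
    hne (n - j) (by omega) (by rw [sum_slope_eq_of_chebU_eq_zero _ _ _ h2 h3])
  -- The case m = 0 says λ_n ≠ 0, which is what the exact degree requires.
  have h0 := hne 0 (by omega)
  rw [Finset.sum_range_zero, neg_zero, ne_eq, eq_comm, neg_eq_zero] at h0
  subst hlam
  simp only [hypergeometricOp_eq_seqHypergeometric σt τt hw]
  rw [seqHypergeometric_eq_zero_iff hX hw (S := sigmaSeq x N σt τt) hσ hρ hr hslope n hn hα h0]
  have hshift : ∀ t : ℤ, shiftedLattice x (-((n : ℤ) + 1)) (N + t) =
      latticeSeq x N (2 * t - (n + 1)) := fun t => by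
    rw [shiftedLattice, latticeSeq]
    push_cast
    congr 1
    ring
  simp only [deltaIter_eq_seqDeltaIter, weightProd_eq_seqWeight, nablaIntegral_eq_seqIntegral,
    hshift, ← sub_eq_add_neg]
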